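/- Let $E=(E^0,E^1,r,s)$ be a directed graph (loops and multiple edges allowed, $E^1$ possibly infinite) with a finite nonempty vertex set $E^0$. Assume that $E$ has no sinks (every vertex is the source $s(e)$ of some edge $e$), has no sources (every vertex is the range $r(e)$ of some edge $e$), and is weakly connected (for all $v,w\in E^0$ there is a finite sequence of vertices $v=v_1,\dots,v_n=w$ such that for each $1\le i<n$ there is an edge from $v_i$ to $v_{i+1}$ or an edge from $v_{i+1}$ to $v_i$). Let $A=C_0(E^0)$, where $E^0$ is discrete, and let $X(E)$ be the graph correspondence, i.e. the $C^*$-correspondence over $A$ $$X(E)=\Big\{\xi:E^1\to\mathbb C \;:\; v\mapsto \sum_{r(e)=v}|\xi(e)|^2 \text{ is in } C_0(E^0)\Big\}$$ with $(a\cdot\xi)(e)=a(s(e))\xi(e)$, $(\xi\cdot a)(e)=\xi(e)a(r(e))$ and $\langle\xi,\eta\rangle(v)=\sum_{r(e)=v}\overline{\xi(e)}\,\eta(e)$. Let $X(E)^{\otimes 0}=A$ be the identity correspondence (left and right multiplication, $\langle a,b\rangle=a^*b$), and for $n\ge 1$ let $X(E)^{\otimes n}$ be the $n$-fold (completed) $A$-balanced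 tensor product of $X(E)$ with itself. An isomorphism of $C^*$-correspondences over $A$ is a bijection that preserves the left action and the $A$-valued inner product. Call $X(E)$ nonperiodic if for every integer $n\ge 0$, $X(E)^{\otimes n}\cong A$ as $C^*$-correspondences implies $n=0$. Then the following are equivalent: 1. $X(E)$ is nonperiodic. 2. $E$ is not a simple cycle; that is, there are no $k\ge1$ and enumerations without repetition $E^0=\{v_1,\dots,v_k\}$, $E^1=\{e_1,\dots,e_k\}$ such that $s(e_i)=v_i$ and $r(e_i)=v_{i+1}$ for all $i$, with $v_{k+1}=v_1$. -/

import Mathlib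

open scoped TensorProduct ZeroAtInfty

/-- An element of a C*-algebra is positive when it is of the form `b* b`. -/
def IsPositiveElement {A : Type*} [NonUnitalCStarAlgebra A] (a : A) : Prop :=
  ∃ b : A, a = star b * b

/-- The data of a (possibly degenerate, possibly incomplete) C*-correspondence on a complex vector
space `X`: an `A`-valued inner product, conjugate linear in the first variable and possibly with
null vectors, a right action `right a x = x · a`, and a left action `left a x = a · x` of `A` by
operators with adjoints `(left a)* = left a*`. -/
structure SemiCorrespondence (A X : Type*) [NonUnitalCStarAlgebra A] [AddCommGroup X]
    [Module ℂ X] where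
  inner : X →ₗ⋆[ℂ] X →ₗ[ℂ] A
  right : A →ₗ[ℂ] X →ₗ[ℂ] X
  left : A →ₗ[ℂ] X →ₗ[ℂ] X
  star_inner : ∀ x y, star (inner x y) = inner y x
  inner_self_pos : ∀ x, IsPositiveElement (inner x x)
  inner_right : ∀ x y a, inner x (right a y) = inner x y * a
  right_mul : ∀ a b x, right (a * b) x = right b (right a x)
  left_mul : ∀ a b x, left (a * b) x = left a (left b x)
  inner_left : ∀ a x y, inner (left a x) y = inner x (left (star a) y)

/-- A C*-correspondence over `A`: a right Hilbert `A`-module, complete in the norm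
`‖x‖ = ‖⟨x, x⟩‖ ^ (1 / 2)`, with a left action of `A` by a `*`-homomorphism into the adjointable
operators. (Adjointable operators on a Hilbert module are automatically bounded and right
`A`-linear.) -/
structure CStarCorrespondence.{u} (A : Type u) [NonUnitalCStarAlgebra A] where
  carrier : Type u
  [normedAddCommGroup : NormedAddCommGroup carrier]
  [normedSpace : NormedSpace ℂ carrier]
  [completeSpace : CompleteSpace carrier]
  str : SemiCorrespondence A carrier
  norm_sq : ∀ x : carrier, ‖x‖ ^ 2 = ‖str.inner x x‖

attribute [instance] CStarCorrespondence.normedAddCommGroup CStarCorrespondence.normedSpace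
  CStarCorrespondence.completeSpace

section Positivity

variable {A : Type*} [NonUnitalCStarAlgebra A]

theorem isPositiveElement_iff_nonneg [PartialOrder A] [StarOrderedRing A] (a : A) :
    IsPositiveElement a ↔ 0 ≤ a :=
  CStarAlgebra.nonneg_iff_eq_star_mul_self.symm

theorem IsPositiveElement.sum {ι : Type*} (s : Finset ι) (f : ι → A)
    (h : ∀ i ∈ s, IsPositiveElement (f i)) : IsPositiveElement (∑ i ∈ s, f i) := by
  let _ : PartialOrder A := CStarAlgebra.spectralOrder A
  have _ : StarOrderedRing A := CStarAlgebra.spectralOrderedRing A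
  rw [isPositiveElement_iff_nonneg]
  exact Finset.sum_nonneg fun i hi => (isPositiveElement_iff_nonneg _).1 (h i hi)

/-- The negative part `N` of a self-adjoint element `m`, with a factorization. -/
theorem exists_negPart (m : A) (hm : star m = m) : ∃ N K : A, star N = N ∧ N = star K * K ∧
    m * N = -(N * N) ∧ (N = 0 → ∃ b : A, m = star b * b) := by
  let _ : PartialOrder A := CStarAlgebra.spectralOrder A
  have _ : StarOrderedRing A := CStarAlgebra.spectralOrderedRing A
  have hN0 : 0 ≤ m⁻ := CFC.negPart_nonneg m
  have hMsub : m⁺ - m⁻ = m := CFC.posPart_sub_negPart m hm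
  have hPN : m⁺ * m⁻ = 0 := CFC.posPart_mul_negPart m
  obtain ⟨K, hK⟩ := CStarAlgebra.nonneg_iff_eq_star_mul_self.1 hN0
  refine ⟨m⁻, K, IsSelfAdjoint.of_nonneg hN0, hK, ?_, fun hN => ?_⟩
  · conv_lhs => lhs; rw [← hMsub]
    rw [sub_mul, hPN, zero_sub]
  · refine CStarAlgebra.nonneg_iff_eq_star_mul_self.1 ?_
    rw [← hMsub, hN, sub_zero]
    exact CFC.posPart_nonneg m

/-- A self-adjoint matrix over a C*-algebra whose quadratic form is positive is of the form
`B* B`. -/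
theorem exists_matrix_factor {n : Type*} [Fintype n] (M : CStarMatrix n n A)
    (hM : star M = M)
    (hpos : ∀ v : n → A, IsPositiveElement (∑ i, ∑ j, star (v i) * M i j * v j)) :
    ∃ B : CStarMatrix n n A, M = star B * B := by
  let _ : PartialOrder A := CStarAlgebra.spectralOrder A
  have _ : StarOrderedRing A := CStarAlgebra.spectralOrderedRing A
  obtain ⟨N, K, hNs, hK, hMN, hconcl⟩ := exists_negPart M hM
  have hsum : star N * (M * N) + star (K * N) * (K * N) = 0 := by
    rw [hMN, star_mul, hNs]
    have : N * star K * (K * N) = N * (star K * K) * N := by simp only [mul_assoc]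
    rw [this, ← hK]
    simp [mul_assoc]
  have hR : K * N = 0 := by
    refine CStarMatrix.ext fun i k => ?_
    have h1 : (star N * (M * N)) k k = ∑ i, ∑ j, star (N i k) * M i j * N j k := by
      simp [CStarMatrix.mul_apply, CStarMatrix.star_apply, Finset.mul_sum, mul_assoc]
    have h2 : (star (K * N) * (K * N)) k k
        = ∑ i, star ((K * N) i k) * (K * N) i k := by
      rw [CStarMatrix.mul_apply]
      simp [CStarMatrix.star_apply]
    have h3 : (star N * (M * N)) k k + (star (K * N) * (K * N)) k k = 0 := by
      have := congrArg (fun Z : CStarMatrix n n A => Z k k) hsum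
      simpa using this
    have h4 : 0 ≤ (star N * (M * N)) k k := by
      rw [h1]; exact (isPositiveElement_iff_nonneg _).1 (hpos fun i => N i k)
    have h5 : ∀ i ∈ Finset.univ, 0 ≤ star ((K * N) i k) * (K * N) i k :=
      fun i _ => star_mul_self_nonneg _
    have h6 : ∑ i, star ((K * N) i k) * (K * N) i k = 0 := by
      rw [h2] at h3
      exact ((add_eq_zero_iff_of_nonneg h4 (Finset.sum_nonneg h5)).1 h3).2
    have h7 := (Finset.sum_eq_zero_iff_of_nonneg h5).1 h6 i (Finset.mem_univ i)
    simpa using CStarRing.star_mul_self_eq_zero_iff _ |>.1 h7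
  have hNN : N * N = 0 := by
    conv_lhs => lhs; rw [hK]
    rw [mul_assoc, hR, mul_zero]
  have hN : N = 0 := by
    have : star N * N = 0 := by rw [hNs, hNN]
    exact (CStarRing.star_mul_self_eq_zero_iff _).1 this
  exact hconcl hN

end Positivity

namespace SemiCorrespondence

variable {A X Y : Type*} [NonUnitalCStarAlgebra A] [AddCommGroup X] [Module ℂ X]
  [AddCommGroup Y] [Module ℂ Y]

theorem right_inner (P : SemiCorrespondence A X) (a : A) (x y : X) :
    P.inner (P.right a x) y = star a * P.inner x y := by
  rw [← P.star_inner, P.inner_right, star_mul, P.star_inner]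

/-- The Gram matrix of finitely many vectors is of the form `B* B`. -/
theorem exists_gram_factor (P : SemiCorrespondence A X) {n : Type*} [Fintype n] (x : n → X) :
    ∃ B : n → n → A, ∀ i j, P.inner (x i) (x j) = ∑ k, star (B k i) * B k j := by
  have hpos : ∀ v : n → A, IsPositiveElement
      (∑ i, ∑ j, star (v i) * P.inner (x i) (x j) * v j) := fun v => by
    have h : P.inner (∑ i, P.right (v i) (x i)) (∑ i, P.right (v i) (x i))
        = ∑ i, ∑ j, star (v i) * P.inner (x i) (x j) * v j := by
      simp only [map_sum, LinearMap.sum_apply, P.inner_right, P.right_inner]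
      exact Finset.sum_comm
    rw [← h]
    exact P.inner_self_pos _
  let M : CStarMatrix n n A := fun i j => P.inner (x i) (x j)
  have hM : star M = M := CStarMatrix.ext fun i j => P.star_inner _ _
  obtain ⟨B, hB⟩ := exists_matrix_factor M hM hpos
  refine ⟨B, fun i j => ?_⟩
  have h : M i j = (star B * B) i j := by rw [← hB]
  rw [CStarMatrix.mul_apply] at h
  exact h

/-- For fixed `x` and `y`, the linear functional `x' ⊗ y' ↦ ⟨y, ⟨x, x'⟩ · y'⟩`. -/
noncomputable def tensorInnerAux (P : SemiCorrespondence A X) (Q : SemiCorrespondence A Y)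
    (x : X) (y : Y) : X ⊗[ℂ] Y →ₗ[ℂ] A :=
  TensorProduct.lift ((Q.left ∘ₗ P.inner x).compr₂ (Q.inner y))

@[simp]
theorem tensorInnerAux_tmul (P : SemiCorrespondence A X) (Q : SemiCorrespondence A Y)
    (x x' : X) (y y' : Y) :
    tensorInnerAux P Q x y (x' ⊗ₜ y') = Q.inner y (Q.left (P.inner x x') y') :=
  rfl

/-- The `A`-valued inner product on the algebraic tensor product, determined by
`⟨x ⊗ y, x' ⊗ y'⟩ = ⟨y, ⟨x, x'⟩ · y'⟩`. -/
noncomputable def tensorInner (P : SemiCorrespondence A X) (Q : SemiCorrespondence A Y) :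
    X ⊗[ℂ] Y →ₗ⋆[ℂ] X ⊗[ℂ] Y →ₗ[ℂ] A :=
  TensorProduct.lift <|
    LinearMap.mk₂'ₛₗ (starRingEnd ℂ) (starRingEnd ℂ) (tensorInnerAux P Q)
      (fun _ _ _ => TensorProduct.ext' fun _ _ => by
        simp only [tensorInnerAux_tmul, map_add, LinearMap.add_apply])
      (fun _ _ _ => TensorProduct.ext' fun _ _ => by
        simp only [tensorInnerAux_tmul, map_smulₛₗ, LinearMap.smul_apply, RingHom.id_apply])
      (fun _ _ _ => TensorProduct.ext' fun _ _ => by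
        simp only [tensorInnerAux_tmul, map_add, LinearMap.add_apply])
      (fun _ _ _ => TensorProduct.ext' fun _ _ => by
        simp only [tensorInnerAux_tmul, map_smulₛₗ, LinearMap.smul_apply])

@[simp]
theorem tensorInner_tmul (P : SemiCorrespondence A X) (Q : SemiCorrespondence A Y)
    (x x' : X) (y y' : Y) :
    tensorInner P Q (x ⊗ₜ y) (x' ⊗ₜ y') = Q.inner y (Q.left (P.inner x x') y') :=
  rfl

/-- The algebraic tensor product over `ℂ` of two correspondences over `A`, with
`⟨x ⊗ y, x' ⊗ y'⟩ = ⟨y, ⟨x, x'⟩ · y'⟩`, `(x ⊗ y) · a = x ⊗ (y · a)` and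
`a · (x ⊗ y) = (a · x) ⊗ y`. The differences `(x · a) ⊗ y - x ⊗ (a · y)` are null vectors. -/
noncomputable def tensor (P : SemiCorrespondence A X) (Q : SemiCorrespondence A Y) :
    SemiCorrespondence A (X ⊗[ℂ] Y) where
  inner := tensorInner P Q
  right := LinearMap.lTensorHom X ∘ₗ Q.right
  left := LinearMap.rTensorHom Y ∘ₗ P.left
  star_inner z w := by
    induction z with
    | zero => simp
    | add z z' hz hz' => simp only [map_add, LinearMap.add_apply, star_add, hz, hz']
    | tmul x y =>
      induction w with
      | zero => simp
      | add w w' hw hw' => simp only [map_add, LinearMap.add_apply, star_add, hw, hw']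
      | tmul x' y' => simp only [tensorInner_tmul, Q.star_inner, Q.inner_left, P.star_inner]
  inner_self_pos z := by
    obtain ⟨S, rfl⟩ := TensorProduct.exists_finset z
    obtain ⟨B, hB⟩ := P.exists_gram_factor (fun i : S => i.1.1)
    have h : tensorInner P Q (∑ i ∈ S, i.1 ⊗ₜ i.2) (∑ i ∈ S, i.1 ⊗ₜ i.2)
        = ∑ k : S, Q.inner (∑ i : S, Q.left (B k i) i.1.2) (∑ i : S, Q.left (B k i) i.1.2) := by
      rw [← Finset.sum_coe_sort S]
      simp only [map_sum, LinearMap.sum_apply, tensorInner_tmul, hB, Q.inner_left, Q.left_mul]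
      rw [Finset.sum_comm_cycle]
    rw [h]
    exact IsPositiveElement.sum _ _ fun k _ => Q.inner_self_pos _
  inner_right z w a := by
    induction z with
    | zero => simp
    | add z z' hz hz' => simp only [map_add, LinearMap.add_apply, add_mul, hz, hz']
    | tmul x y =>
      induction w with
      | zero => simp
      | add w w' hw hw' => simp only [map_add, add_mul, hw, hw']
      | tmul x' y' =>
        simp only [LinearMap.comp_apply, LinearMap.coe_lTensorHom, LinearMap.lTensor_tmul,
          tensorInner_tmul]
        rw [← star_star (P.inner x x'), ← Q.inner_left, Q.inner_right, Q.inner_left]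
  right_mul a b z := by
    induction z with
    | zero => simp
    | add z z' hz hz' => simp only [map_add, hz, hz']
    | tmul x y => simp [Q.right_mul]
  left_mul a b z := by
    induction z with
    | zero => simp
    | add z z' hz hz' => simp only [map_add, hz, hz']
    | tmul x y => simp [P.left_mul]
  inner_left a z w := by
    induction z with
    | zero => simp
    | add z z' hz hz' => simp only [map_add, LinearMap.add_apply, hz, hz']
    | tmul x y =>
      induction w with
      | zero => simp
      | add w w' hw hw' => simp only [map_add, hw, hw']
      | tmul x' y' =>
        simp only [LinearMap.comp_apply, LinearMap.coe_rTensorHom, LinearMap.rTensor_tmul,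
          tensorInner_tmul, P.inner_left]

section Bounds

variable (P : SemiCorrespondence A X)

theorem norm_inner_sq_le (x y : X) :
    ‖P.inner x y‖ ^ 2 ≤ ‖P.inner x x‖ * ‖P.inner y y‖ := by
  let _ : PartialOrder A := CStarAlgebra.spectralOrder A
  have _ : StarOrderedRing A := CStarAlgebra.spectralOrderedRing A
  have key : ∀ t : ℝ, 0 < t → ‖P.inner x x‖ ≤ t →
      ‖P.inner x y‖ ^ 2 ≤ t * ‖P.inner y y‖ := by
    intro t ht hxt
    set a := P.inner x y with ha
    have hpos := (isPositiveElement_iff_nonneg _).1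
      (P.inner_self_pos (P.right a x - (t : ℂ) • y))
    have hexp : P.inner (P.right a x - (t : ℂ) • y) (P.right a x - (t : ℂ) • y)
        = star a * P.inner x x * a - t • (star a * a) - t • (star a * a)
          + t • t • P.inner y y := by
      have h1 : P.inner y x = star a := by rw [ha, P.star_inner]
      simp only [map_sub, LinearMap.sub_apply, map_smulₛₗ, LinearMap.smul_apply, P.inner_right,
        P.right_inner, RingHom.id_apply, Complex.conj_ofReal, ← ha, h1]
      simp only [Complex.coe_smul, mul_assoc, smul_sub]
      abel
    have hconj : star a * P.inner x x * a ≤ t • (star a * a) :=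
      (CStarAlgebra.star_left_conjugate_le_norm_smul
        (hb := (isPositiveElement_iff_nonneg _).1 (P.inner_self_pos x) |>.isSelfAdjoint)).trans
        (smul_le_smul_of_nonneg_right hxt (star_mul_self_nonneg a))
    have hle : t • (star a * a) ≤ t • t • P.inner y y := by
      rw [hexp] at hpos
      rw [← sub_nonneg]
      refine hpos.trans ?_
      rw [← sub_nonneg]
      have : t • t • P.inner y y - t • (star a * a) - (star a * P.inner x x * a
          - t • (star a * a) - t • (star a * a) + t • t • P.inner y y)
          = t • (star a * a) - star a * P.inner x x * a := by abel
      rw [this, sub_nonneg]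
      exact hconj
    have hn := CStarAlgebra.norm_le_norm_of_nonneg_of_le
      (smul_nonneg ht.le (star_mul_self_nonneg a)) hle
    rw [norm_smul, norm_smul, norm_smul, CStarRing.norm_star_mul_self, Real.norm_of_nonneg ht.le]
      at hn
    have := le_of_mul_le_mul_left hn ht
    rwa [sq]
  have hlim : Filter.Tendsto (fun ε : ℝ => (‖P.inner x x‖ + ε) * ‖P.inner y y‖)
      (nhdsWithin 0 (Set.Ioi 0)) (nhds ((‖P.inner x x‖ + 0) * ‖P.inner y y‖)) :=
    Filter.Tendsto.mono_left (Continuous.tendsto (by fun_prop) 0) nhdsWithin_le_nhds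
  rw [add_zero] at hlim
  refine ge_of_tendsto hlim ?_
  filter_upwards [self_mem_nhdsWithin] with ε hε
  exact key _ (add_pos_of_nonneg_of_pos (norm_nonneg _) hε) (le_add_of_nonneg_right hε.le)

theorem norm_inner_right_le (a : A) (x : X) :
    ‖P.inner (P.right a x) (P.right a x)‖ ≤ ‖a‖ ^ 2 * ‖P.inner x x‖ := by
  rw [P.inner_right, P.right_inner]
  refine (norm_mul_le _ _).trans ?_
  refine (mul_le_mul_of_nonneg_right (norm_mul_le _ _) (norm_nonneg _)).trans ?_
  rw [norm_star]
  exact le_of_eq (by ring)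

theorem norm_inner_left_le (a : A) (x : X) :
    ‖P.inner (P.left a x) (P.left a x)‖ ≤ ‖a‖ ^ 2 * ‖P.inner x x‖ := by
  let _ : PartialOrder A := CStarAlgebra.spectralOrder A
  have _ : StarOrderedRing A := CStarAlgebra.spectralOrderedRing A
  let _ : PartialOrder (Unitization ℂ A) := CStarAlgebra.spectralOrder _
  have _ : StarOrderedRing (Unitization ℂ A) := CStarAlgebra.spectralOrderedRing _
  have hle : star (a : Unitization ℂ A) * a ≤ algebraMap ℝ _ (‖a‖ ^ 2) := by
    have h := IsSelfAdjoint.le_algebraMap_norm_self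
      (IsSelfAdjoint.star_mul_self (a : Unitization ℂ A))
    rwa [CStarRing.norm_star_mul_self, Unitization.norm_inr, ← sq] at h
  obtain ⟨c, hc⟩ := CStarAlgebra.nonneg_iff_eq_star_mul_self.1 (sub_nonneg.2 hle)
  have h1 := congrArg (fun u : Unitization ℂ A => u.fst) hc
  have h2 := congrArg (fun u : Unitization ℂ A => u.snd) hc
  have h3 : (starRingEnd ℂ) c.fst * c.fst = ((‖a‖ ^ 2 : ℝ) : ℂ) := by
    simpa [Algebra.algebraMap_eq_smul_one, sub_eq_add_neg] using h1.symm
  have h4 : (starRingEnd ℂ) c.fst • c.snd + c.fst • star c.snd + star c.snd * c.snd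
      = -(star a * a) := by
    simpa [Algebra.algebraMap_eq_smul_one, sub_eq_add_neg] using h2.symm
  have hpos := (isPositiveElement_iff_nonneg _).1
    (P.inner_self_pos (c.fst • x + P.left c.snd x))
  have hexp : P.inner (c.fst • x + P.left c.snd x) (c.fst • x + P.left c.snd x)
      = (‖a‖ ^ 2) • P.inner x x - P.inner (P.left a x) (P.left a x) := by
    rw [P.inner_left a, ← P.left_mul]
    have h5 := congrArg (fun b => P.inner x (P.left b x)) h4
    simp only [map_add, map_neg, map_smul, LinearMap.add_apply, LinearMap.neg_apply,
      LinearMap.smul_apply] at h5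
    rw [← Complex.coe_smul, ← h3, mul_comm, sub_eq_add_neg, ← h5]
    simp only [map_add, LinearMap.add_apply, map_smulₛₗ, LinearMap.smul_apply, P.inner_left,
      ← P.left_mul, RingHom.id_apply, mul_smul, smul_add]
    abel
  rw [hexp, sub_nonneg] at hpos
  have hn := CStarAlgebra.norm_le_norm_of_nonneg_of_le
    ((isPositiveElement_iff_nonneg _).1 (P.inner_self_pos (P.left a x))) hpos
  rwa [norm_smul, Real.norm_of_nonneg (by positivity)] at hn

end Bounds

/-- The space `X` of a semi-inner product correspondence, with the seminorm
`‖x‖ = ‖⟨x, x⟩‖ ^ (1 / 2)`. -/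
def Space (_ : SemiCorrespondence A X) : Type _ := X

section Space

variable (P : SemiCorrespondence A X)

instance : AddCommGroup P.Space := inferInstanceAs (AddCommGroup X)

instance : Module ℂ P.Space := inferInstanceAs (Module ℂ X)

/-- The structure `P`, seen on `P.Space`. -/
def onSpace : SemiCorrespondence A P.Space := P

noncomputable instance : Norm P.Space := ⟨fun x => √‖P.onSpace.inner x x‖⟩

theorem space_norm_sq (x : P.Space) : ‖x‖ ^ 2 = ‖P.onSpace.inner x x‖ :=
  Real.sq_sqrt (norm_nonneg _)

theorem norm_inner_le (x y : P.Space) : ‖P.onSpace.inner x y‖ ≤ ‖x‖ * ‖y‖ := by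
  have h := P.onSpace.norm_inner_sq_le x y
  rw [← P.space_norm_sq, ← P.space_norm_sq, ← mul_pow] at h
  exact (pow_le_pow_iff_left₀ (norm_nonneg _)
    (mul_nonneg (Real.sqrt_nonneg _) (Real.sqrt_nonneg _)) two_ne_zero).1 h

theorem seminormCore : SeminormedSpace.Core ℂ P.Space where
  norm_nonneg _ := Real.sqrt_nonneg _
  norm_smul c x := by
    have h : P.onSpace.inner (c • x) (c • x) = (star c * c) • P.onSpace.inner x x := by
      rw [map_smul, map_smulₛₗ, LinearMap.smul_apply, smul_smul, mul_comm]
      rfl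
    change √‖P.onSpace.inner (c • x) (c • x)‖ = ‖c‖ * √‖P.onSpace.inner x x‖
    rw [h, norm_smul, CStarRing.norm_star_mul_self, Real.sqrt_mul (by positivity),
      Real.sqrt_mul_self (norm_nonneg _)]
  norm_triangle x y := by
    have hx : 0 ≤ ‖x‖ := Real.sqrt_nonneg _
    have hy : 0 ≤ ‖y‖ := Real.sqrt_nonneg _
    have hxy : 0 ≤ ‖x + y‖ := Real.sqrt_nonneg _
    refine (pow_le_pow_iff_left₀ hxy (add_nonneg hx hy) two_ne_zero).1 ?_
    rw [P.space_norm_sq]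
    have h : P.onSpace.inner (x + y) (x + y)
        = P.onSpace.inner x x + P.onSpace.inner x y + (P.onSpace.inner y x + P.onSpace.inner y y) := by
      simp only [map_add, LinearMap.add_apply]
      abel
    rw [h]
    refine (norm_add_le _ _).trans ((add_le_add (norm_add_le _ _) (norm_add_le _ _)).trans ?_)
    have h1 := P.norm_inner_le x y
    have h2 := P.norm_inner_le y x
    rw [← P.space_norm_sq, ← P.space_norm_sq]
    nlinarith

noncomputable instance : SeminormedAddCommGroup P.Space :=
  SeminormedAddCommGroup.ofCore P.seminormCore

noncomputable instance : NormedSpace ℂ P.Space where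
  norm_smul_le c x := (P.seminormCore.norm_smul c x).le

theorem norm_right_le (a : A) (x : P.Space) : ‖P.onSpace.right a x‖ ≤ ‖a‖ * ‖x‖ := by
  refine (pow_le_pow_iff_left₀ (norm_nonneg _) (by positivity) two_ne_zero).1 ?_
  rw [mul_pow, P.space_norm_sq, P.space_norm_sq]
  exact P.onSpace.norm_inner_right_le a x

theorem norm_left_le (a : A) (x : P.Space) : ‖P.onSpace.left a x‖ ≤ ‖a‖ * ‖x‖ := by
  refine (pow_le_pow_iff_left₀ (norm_nonneg _) (by positivity) two_ne_zero).1 ?_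
  rw [mul_pow, P.space_norm_sq, P.space_norm_sq]
  exact P.onSpace.norm_inner_left_le a x

/-- The inner product as a bounded sesquilinear map. -/
noncomputable def innerL : P.Space →L⋆[ℂ] P.Space →L[ℂ] A :=
  LinearMap.mkContinuous₂ P.onSpace.inner 1
    fun x y => by rw [one_mul]; exact P.norm_inner_le x y

/-- The right action of `a` as a bounded operator. -/
noncomputable def rightL (a : A) : P.Space →L[ℂ] P.Space :=
  LinearMap.mkContinuous (P.onSpace.right a) ‖a‖
    (P.norm_right_le a)

/-- The left action of `a` as a bounded operator. -/
noncomputable def leftL (a : A) : P.Space →L[ℂ] P.Space :=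
  LinearMap.mkContinuous (P.onSpace.left a) ‖a‖
    (P.norm_left_le a)

/-- The Hausdorff completion of the space of `P`. -/
abbrev Compl : Type _ := UniformSpace.Completion P.Space

/-- Extension by continuity of the inner product in its second variable. -/
noncomputable def innerComplAux : P.Space →L⋆[ℂ] P.Compl →L[ℂ] A :=
  LinearMap.mkContinuous
    { toFun := fun x => (P.innerL x).fromCompletion
      map_add' := fun x y => ContinuousLinearMap.fromCompletion_unique _ _ fun e => by simp
      map_smul' := fun c x => ContinuousLinearMap.fromCompletion_unique _ _ fun e => by simp }
    1 fun x => by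
      rw [one_mul]
      refine ContinuousLinearMap.opNorm_le_bound _ (norm_nonneg _) fun z => ?_
      induction z using UniformSpace.Completion.induction_on with
      | hp => exact isClosed_le (by fun_prop) (by fun_prop)
      | ih y =>
        simpa using! P.norm_inner_le x y

/-- Extension by continuity of the inner product to the completion. -/
noncomputable def innerCompl : P.Compl →L⋆[ℂ] P.Compl →L[ℂ] A :=
  P.innerComplAux.fromCompletion

theorem innerCompl_coe (x y : P.Space) : P.innerCompl (x : P.Compl) (y : P.Compl) = P.onSpace.inner x y := by
  unfold innerCompl
  rw [ContinuousLinearMap.fromCompletion_apply_coe]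
  exact ContinuousLinearMap.fromCompletion_apply_coe (P.innerL x) y

theorem innerCompl_continuous : Continuous fun p : P.Compl × P.Compl => P.innerCompl p.1 p.2 := by
  fun_prop

theorem rightL_apply (a : A) (x : P.Space) : P.rightL a x = P.onSpace.right a x := rfl

theorem leftL_apply (a : A) (x : P.Space) : P.leftL a x = P.onSpace.left a x := rfl

/-- Extension by continuity of the right action to the completion. -/
noncomputable def rightCompl : A →ₗ[ℂ] P.Compl →ₗ[ℂ] P.Compl where
  toFun a := ((P.rightL a).completion : P.Compl →L[ℂ] P.Compl)
  map_add' a b := by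
    refine LinearMap.ext fun z => ?_
    simp only [LinearMap.add_apply, ContinuousLinearMap.coe_coe]
    induction z using UniformSpace.Completion.induction_on with
    | hp => exact isClosed_eq (by fun_prop) (by fun_prop)
    | ih x =>
      simp only [ContinuousLinearMap.completion_apply_coe, rightL_apply, map_add,
        LinearMap.add_apply, UniformSpace.Completion.coe_add]
  map_smul' c a := by
    refine LinearMap.ext fun z => ?_
    simp only [LinearMap.smul_apply, ContinuousLinearMap.coe_coe, RingHom.id_apply]
    induction z using UniformSpace.Completion.induction_on with
    | hp =>
      exact isClosed_eq (P.rightL (c • a)).completion.continuous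
        ((P.rightL a).completion.continuous.const_smul c)
    | ih x =>
      simp only [ContinuousLinearMap.completion_apply_coe, rightL_apply, map_smul,
        LinearMap.smul_apply, UniformSpace.Completion.coe_smul]

@[fun_prop]
theorem rightCompl_continuous (a : A) : Continuous fun z : P.Compl => P.rightCompl a z :=
  (P.rightL a).completion.continuous

theorem rightCompl_coe (a : A) (x : P.Space) :
    P.rightCompl a (x : P.Compl) = (P.onSpace.right a x : P.Space) :=
  ContinuousLinearMap.completion_apply_coe _ _

/-- Extension by continuity of the left action to the completion. -/
noncomputable def leftCompl : A →ₗ[ℂ] P.Compl →ₗ[ℂ] P.Compl where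
  toFun a := ((P.leftL a).completion : P.Compl →L[ℂ] P.Compl)
  map_add' a b := by
    refine LinearMap.ext fun z => ?_
    simp only [LinearMap.add_apply, ContinuousLinearMap.coe_coe]
    induction z using UniformSpace.Completion.induction_on with
    | hp => exact isClosed_eq (by fun_prop) (by fun_prop)
    | ih x =>
      simp only [ContinuousLinearMap.completion_apply_coe, leftL_apply, map_add,
        LinearMap.add_apply, UniformSpace.Completion.coe_add]
  map_smul' c a := by
    refine LinearMap.ext fun z => ?_
    simp only [LinearMap.smul_apply, ContinuousLinearMap.coe_coe, RingHom.id_apply]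
    induction z using UniformSpace.Completion.induction_on with
    | hp =>
      exact isClosed_eq (P.leftL (c • a)).completion.continuous
        ((P.leftL a).completion.continuous.const_smul c)
    | ih x =>
      simp only [ContinuousLinearMap.completion_apply_coe, leftL_apply, map_smul,
        LinearMap.smul_apply, UniformSpace.Completion.coe_smul]

@[fun_prop]
theorem leftCompl_continuous (a : A) : Continuous fun z : P.Compl => P.leftCompl a z :=
  (P.leftL a).completion.continuous

theorem leftCompl_coe (a : A) (x : P.Space) :
    P.leftCompl a (x : P.Compl) = (P.onSpace.left a x : P.Space) :=
  ContinuousLinearMap.completion_apply_coe _ _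

/-- The correspondence structure on the completion, extending that of `P` by continuity. -/
noncomputable def complStr : SemiCorrespondence A P.Compl where
  inner := P.innerCompl.toLinearMap₁₂
  right := P.rightCompl
  left := P.leftCompl
  star_inner z w := by
    simp only [ContinuousLinearMap.toLinearMap₁₂_apply_apply_apply]
    induction z, w using UniformSpace.Completion.induction_on₂ with
    | hp => exact isClosed_eq (by fun_prop) (by fun_prop)
    | ih x y => rw [innerCompl_coe, innerCompl_coe, P.onSpace.star_inner]
  inner_self_pos z := by
    simp only [ContinuousLinearMap.toLinearMap₁₂_apply_apply_apply]
    let _ : PartialOrder A := CStarAlgebra.spectralOrder A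
    have _ : StarOrderedRing A := CStarAlgebra.spectralOrderedRing A
    rw [isPositiveElement_iff_nonneg]
    induction z using UniformSpace.Completion.induction_on with
    | hp =>
      exact CStarAlgebra.isClosed_nonneg.preimage
        (P.innerCompl_continuous.comp (continuous_id.prodMk continuous_id))
    | ih x =>
      rw [innerCompl_coe]
      exact (isPositiveElement_iff_nonneg _).1 (P.onSpace.inner_self_pos x)
  inner_right z w a := by
    simp only [ContinuousLinearMap.toLinearMap₁₂_apply_apply_apply]
    induction z, w using UniformSpace.Completion.induction_on₂ with
    | hp => exact isClosed_eq (by fun_prop) (by fun_prop)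
    | ih x y =>
      rw [rightCompl_coe, innerCompl_coe, innerCompl_coe]
      exact P.onSpace.inner_right x y a
  right_mul a b z := by
    induction z using UniformSpace.Completion.induction_on with
    | hp => exact isClosed_eq (by fun_prop) (by fun_prop)
    | ih x => simp only [rightCompl_coe, P.onSpace.right_mul]
  left_mul a b z := by
    induction z using UniformSpace.Completion.induction_on with
    | hp => exact isClosed_eq (by fun_prop) (by fun_prop)
    | ih x => simp only [leftCompl_coe, P.onSpace.left_mul]
  inner_left a z w := by
    simp only [ContinuousLinearMap.toLinearMap₁₂_apply_apply_apply]
    induction z, w using UniformSpace.Completion.induction_on₂ with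
    | hp => exact isClosed_eq (by fun_prop) (by fun_prop)
    | ih x y =>
      rw [leftCompl_coe, leftCompl_coe, innerCompl_coe, innerCompl_coe]
      exact P.onSpace.inner_left a x y

theorem complStr_norm_sq (z : P.Compl) : ‖z‖ ^ 2 = ‖P.complStr.inner z z‖ := by
  change ‖z‖ ^ 2 = ‖P.innerCompl z z‖
  induction z using UniformSpace.Completion.induction_on with
  | hp => exact isClosed_eq (by fun_prop) (by fun_prop)
  | ih x => rw [innerCompl_coe, UniformSpace.Completion.norm_coe, P.space_norm_sq]

end Space

end SemiCorrespondence

namespace CStarCorrespondence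

universe u

variable {A : Type u} [NonUnitalCStarAlgebra A]

/-- The Hausdorff completion of a semi-inner product correspondence. -/
noncomputable def ofCompletion {X : Type u} [AddCommGroup X] [Module ℂ X]
    (P : SemiCorrespondence A X) : CStarCorrespondence A where
  carrier := P.Compl
  str := P.complStr
  norm_sq := P.complStr_norm_sq

/-- The (interior, `A`-balanced) tensor product `X ⊗_A Y` of C*-correspondences over `A`: the
Hausdorff completion of the algebraic tensor product for
`⟨x ⊗ y, x' ⊗ y'⟩ = ⟨y, ⟨x, x'⟩ · y'⟩`. -/
noncomputable def tensor (X Y : CStarCorrespondence A) : CStarCorrespondence A :=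
  ofCompletion (X.str.tensor Y.str)

variable (A) in
/-- The identity correspondence: `A` over itself, with `⟨a, b⟩ = a* b` and with multiplication as
the left and right action. -/
noncomputable def identity : CStarCorrespondence A where
  carrier := A
  str :=
    { inner := LinearMap.mk₂'ₛₗ (starRingEnd ℂ) (RingHom.id ℂ) (fun a b => star a * b)
        (fun _ _ _ => by simp [add_mul]) (fun _ _ _ => by simp [smul_mul_assoc])
        (fun _ _ _ => by simp [mul_add]) (fun _ _ _ => by simp [mul_smul_comm])
      right := (LinearMap.mul ℂ A).flip
      left := LinearMap.mul ℂ A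
      star_inner := fun _ _ => by simp
      inner_self_pos := fun a => ⟨a, rfl⟩
      inner_right := fun _ _ _ => by simp [mul_assoc]
      right_mul := fun _ _ _ => by simp [mul_assoc]
      left_mul := fun _ _ _ => by simp [mul_assoc]
      inner_left := fun _ _ _ => by simp [mul_assoc] }
  norm_sq a := by simp [CStarRing.norm_star_mul_self, sq]

/-- The tensor powers `X^{⊗ n} = X ⊗_A (X ⊗_A ⋯ )`, with `X^{⊗ 0} = A`. -/
noncomputable def tensorPower (X : CStarCorrespondence A) : ℕ → CStarCorrespondence A
  | 0 => identity A
  | 1 => X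
  | n + 2 => tensor X (tensorPower X (n + 1))

/-- Isomorphism of C*-correspondences: a bijection that preserves the left action and the inner
product (it is then automatically linear and preserves the right action). -/
def Isomorphic (X Y : CStarCorrespondence A) : Prop :=
  ∃ Φ : X.carrier → Y.carrier, Function.Bijective Φ ∧
    (∀ a x, Φ (X.str.left a x) = Y.str.left a (Φ x)) ∧
    ∀ x x', Y.str.inner (Φ x) (Φ x') = X.str.inner x x'

/-- `X` is nonperiodic if `X^{⊗ n} ≅ A` only for `n = 0`. -/
def Nonperiodic (X : CStarCorrespondence A) : Prop :=
  ∀ n : ℕ, Isomorphic (X.tensorPower n) (identity A) → n = 0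

end CStarCorrespondence

/-- A directed graph `E = (E⁰, E¹, r, s)`; loops and multiple edges are allowed. -/
structure DirectedGraph.{u} where
  Vertex : Type u
  Edge : Type u
  r : Edge → Vertex
  s : Edge → Vertex

namespace DirectedGraph

universe u

variable (E : DirectedGraph.{u})

/-- The vertex set carries the discrete topology. -/
instance : TopologicalSpace E.Vertex := ⊥

instance : DiscreteTopology E.Vertex := ⟨rfl⟩

/-- The set `r⁻¹(v)` of edges with range `v`. -/
abbrev Fiber (v : E.Vertex) : Type u := {e : E.Edge // E.r e = v}

/-- The function `v ↦ ∑_{r(e) = v} |ξ(e)|²`. -/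
noncomputable def normSq (ξ : E.Edge → ℂ) (v : E.Vertex) : ℝ := ∑' e : E.Fiber v, ‖ξ e‖ ^ 2

/-- Membership in `X(E)`: the function `v ↦ ∑_{r(e) = v} |ξ(e)|²` is finite everywhere and belongs
to `C₀(E⁰)`. -/
def MemX (ξ : E.Edge → ℂ) : Prop :=
  (∀ v, Summable fun e : E.Fiber v => ‖ξ e‖ ^ 2) ∧
    Filter.Tendsto (E.normSq ξ) (Filter.cocompact E.Vertex) (nhds 0)

variable {E}

theorem normSq_nonneg (ξ : E.Edge → ℂ) (v : E.Vertex) : 0 ≤ E.normSq ξ v :=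
  tsum_nonneg fun _ => by positivity

theorem MemX.of_le {ξ η ζ : E.Edge → ℂ} (hξ : E.MemX ξ) (hη : E.MemX η) (C D : ℝ)
    (h : ∀ e, ‖ζ e‖ ^ 2 ≤ C * ‖ξ e‖ ^ 2 + D * ‖η e‖ ^ 2) : E.MemX ζ := by
  have hsum : ∀ v, Summable fun e : E.Fiber v => C * ‖ξ e‖ ^ 2 + D * ‖η e‖ ^ 2 :=
    fun v => ((hξ.1 v).mul_left C).add ((hη.1 v).mul_left D)
  have hζ : ∀ v, Summable fun e : E.Fiber v => ‖ζ e‖ ^ 2 := fun v =>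
    Summable.of_nonneg_of_le (fun _ => by positivity) (fun e => h e) (hsum v)
  refine ⟨hζ, ?_⟩
  have hlim := (hξ.2.const_mul C).add (hη.2.const_mul D)
  simp only [mul_zero, add_zero] at hlim
  refine squeeze_zero (normSq_nonneg ζ) (fun v => ?_) hlim
  refine (Summable.tsum_le_tsum (fun e : E.Fiber v => h e) (hζ v) (hsum v)).trans (le_of_eq ?_)
  rw [((hξ.1 v).mul_left C).tsum_add ((hη.1 v).mul_left D), tsum_mul_left, tsum_mul_left]
  rfl

theorem norm_add_sq_le (a b : ℂ) : ‖a + b‖ ^ 2 ≤ 2 * ‖a‖ ^ 2 + 2 * ‖b‖ ^ 2 := by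
  have h := norm_add_le a b
  have h' := pow_le_pow_left₀ (norm_nonneg _) h 2
  nlinarith [sq_nonneg (‖a‖ - ‖b‖)]

variable (E) in
/-- The complex vector space underlying `X(E)`. -/
def moduleX : Submodule ℂ (E.Edge → ℂ) where
  carrier := {ξ | E.MemX ξ}
  zero_mem' := by
    refine ⟨fun v => ?_, ?_⟩
    · simp
    · have : E.normSq 0 = 0 := by
        funext v
        simp [normSq]
      rw [this]
      exact tendsto_const_nhds
  add_mem' hξ hη := MemX.of_le hξ hη 2 2 fun _ => norm_add_sq_le _ _
  smul_mem' c ξ hξ := MemX.of_le hξ hξ (‖c‖ ^ 2) 0 fun e => by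
    simp [mul_pow]

theorem norm_conj_mul_le (a b : ℂ) : ‖starRingEnd ℂ a * b‖ ≤ ‖a‖ ^ 2 + ‖b‖ ^ 2 := by
  rw [norm_mul, RCLike.norm_conj]
  nlinarith [sq_nonneg (‖a‖ - ‖b‖), sq_nonneg ‖a‖, sq_nonneg ‖b‖]

theorem summable_inner (ξ η : E.moduleX) (v : E.Vertex) :
    Summable fun e : E.Fiber v => starRingEnd ℂ (ξ.1 e) * η.1 e :=
  Summable.of_norm_bounded ((ξ.2.1 v).add (η.2.1 v)) fun _ => norm_conj_mul_le _ _

/-- The inner product `⟨ξ, η⟩(v) = ∑_{r(e) = v} conj(ξ(e)) η(e)`, an element of `C₀(E⁰)`. -/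
noncomputable def innerX (ξ η : E.moduleX) : C₀(E.Vertex, ℂ) where
  toFun v := ∑' e : E.Fiber v, starRingEnd ℂ (ξ.1 e) * η.1 e
  continuous_toFun := continuous_of_discreteTopology
  zero_at_infty' := by
    have hlim := ξ.2.2.add η.2.2
    rw [add_zero] at hlim
    refine squeeze_zero_norm (fun v => ?_) hlim
    refine (tsum_of_norm_bounded ((ξ.2.1 v).add (η.2.1 v)).hasSum
      fun _ => norm_conj_mul_le _ _).trans (le_of_eq ?_)
    exact (ξ.2.1 v).tsum_add (η.2.1 v)

theorem innerX_apply (ξ η : E.moduleX) (v : E.Vertex) :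
    innerX ξ η v = ∑' e : E.Fiber v, starRingEnd ℂ (ξ.1 e) * η.1 e := rfl

theorem innerX_self_apply (ξ : E.moduleX) (v : E.Vertex) :
    innerX ξ ξ v = (E.normSq ξ.1 v : ℂ) := by
  rw [innerX_apply, normSq, Complex.ofReal_tsum]
  refine tsum_congr fun e => ?_
  rw [Complex.conj_mul', Complex.ofReal_pow]

theorem norm_coe_le (a : C₀(E.Vertex, ℂ)) (v : E.Vertex) : ‖a v‖ ≤ ‖a‖ :=
  a.toBCF.norm_coe_le_norm v

theorem norm_mul_coe_sq_le (a : C₀(E.Vertex, ℂ)) (v : E.Vertex) (z : ℂ) :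
    ‖a v * z‖ ^ 2 ≤ ‖a‖ ^ 2 * ‖z‖ ^ 2 + 0 * ‖z‖ ^ 2 := by
  rw [norm_mul, mul_pow, zero_mul, add_zero]
  gcongr
  exact norm_coe_le a v

theorem memX_right (a : C₀(E.Vertex, ℂ)) {ξ : E.Edge → ℂ} (hξ : E.MemX ξ) :
    E.MemX fun e => ξ e * a (E.r e) :=
  hξ.of_le hξ (‖a‖ ^ 2) 0 fun e => by
    rw [mul_comm (ξ e)]
    exact norm_mul_coe_sq_le a (E.r e) (ξ e)

theorem memX_left (a : C₀(E.Vertex, ℂ)) {ξ : E.Edge → ℂ} (hξ : E.MemX ξ) :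
    E.MemX fun e => a (E.s e) * ξ e :=
  hξ.of_le hξ (‖a‖ ^ 2) 0 fun e => norm_mul_coe_sq_le a (E.s e) (ξ e)

/-- The right action `(ξ · a)(e) = ξ(e) a(r(e))`. -/
noncomputable def rightX (a : C₀(E.Vertex, ℂ)) (ξ : E.moduleX) : E.moduleX :=
  ⟨fun e => ξ.1 e * a (E.r e), memX_right a ξ.2⟩

/-- The left action `(a · ξ)(e) = a(s(e)) ξ(e)`. -/
noncomputable def leftX (a : C₀(E.Vertex, ℂ)) (ξ : E.moduleX) : E.moduleX :=
  ⟨fun e => a (E.s e) * ξ.1 e, memX_left a ξ.2⟩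

variable (E) in
/-- The inner product and the actions of `C₀(E⁰)` on `X(E)`. -/
noncomputable def strX : SemiCorrespondence C₀(E.Vertex, ℂ) E.moduleX where
  inner := LinearMap.mk₂'ₛₗ (starRingEnd ℂ) (RingHom.id ℂ) innerX
    (fun ξ ξ' η => ZeroAtInftyContinuousMap.ext fun v => by
      simp only [innerX_apply, ZeroAtInftyContinuousMap.add_apply]
      rw [← (summable_inner ξ η v).tsum_add (summable_inner ξ' η v)]
      exact tsum_congr fun e => by simp [add_mul])
    (fun c ξ η => ZeroAtInftyContinuousMap.ext fun v => by
      simp only [innerX_apply, ZeroAtInftyContinuousMap.smul_apply, smul_eq_mul]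
      rw [← tsum_mul_left]
      exact tsum_congr fun e => by simp [mul_assoc])
    (fun ξ η η' => ZeroAtInftyContinuousMap.ext fun v => by
      simp only [innerX_apply, ZeroAtInftyContinuousMap.add_apply]
      rw [← (summable_inner ξ η v).tsum_add (summable_inner ξ η' v)]
      exact tsum_congr fun e => by simp [mul_add])
    (fun c ξ η => ZeroAtInftyContinuousMap.ext fun v => by
      simp only [innerX_apply, ZeroAtInftyContinuousMap.smul_apply, smul_eq_mul, RingHom.id_apply]
      rw [← tsum_mul_left]
      exact tsum_congr fun e => by simp [mul_left_comm])
  right := LinearMap.mk₂ ℂ rightX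
    (fun _ _ _ => Subtype.ext <| funext fun _ => mul_add _ _ _)
    (fun _ _ _ => Subtype.ext <| funext fun _ => mul_left_comm _ _ _)
    (fun _ _ _ => Subtype.ext <| funext fun _ => add_mul _ _ _)
    (fun _ _ _ => Subtype.ext <| funext fun _ => mul_assoc _ _ _)
  left := LinearMap.mk₂ ℂ leftX
    (fun _ _ _ => Subtype.ext <| funext fun _ => add_mul _ _ _)
    (fun _ _ _ => Subtype.ext <| funext fun _ => mul_assoc _ _ _)
    (fun _ _ _ => Subtype.ext <| funext fun _ => mul_add _ _ _)
    (fun _ _ _ => Subtype.ext <| funext fun _ => mul_left_comm _ _ _)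
  star_inner ξ η := ZeroAtInftyContinuousMap.ext fun v => by
    simp only [LinearMap.mk₂'ₛₗ_apply, ZeroAtInftyContinuousMap.star_apply, innerX_apply]
    rw [← starRingEnd_apply, Complex.conj_tsum]
    exact tsum_congr fun e => by simp [mul_comm]
  inner_self_pos ξ := by
    refine ⟨⟨⟨fun v => (√(E.normSq ξ.1 v) : ℂ), continuous_of_discreteTopology⟩, ?_⟩, ?_⟩
    · have h := (Complex.continuous_ofReal.tendsto _).comp
        ((Real.continuous_sqrt.tendsto 0).comp ξ.2.2)
      rw [Real.sqrt_zero, Complex.ofReal_zero] at h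
      exact h
    · refine ZeroAtInftyContinuousMap.ext fun v => ?_
      simp only [LinearMap.mk₂'ₛₗ_apply, innerX_self_apply]
      change _ = star (√(E.normSq ξ.1 v) : ℂ) * (√(E.normSq ξ.1 v) : ℂ)
      rw [← starRingEnd_apply, Complex.conj_ofReal, ← Complex.ofReal_mul,
        Real.mul_self_sqrt (normSq_nonneg _ _)]
  inner_right ξ η a := ZeroAtInftyContinuousMap.ext fun v => by
    simp only [LinearMap.mk₂'ₛₗ_apply, LinearMap.mk₂_apply, innerX_apply,
      ZeroAtInftyContinuousMap.mul_apply]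
    rw [← tsum_mul_right]
    refine tsum_congr fun e => ?_
    obtain ⟨e, rfl⟩ := e
    exact (mul_assoc _ _ _).symm
  right_mul _ _ _ := Subtype.ext <| funext fun _ => (mul_assoc _ _ _).symm
  left_mul _ _ _ := Subtype.ext <| funext fun _ => mul_assoc _ _ _
  inner_left a ξ η := ZeroAtInftyContinuousMap.ext fun v => by
    simp only [LinearMap.mk₂'ₛₗ_apply, LinearMap.mk₂_apply, innerX_apply]
    refine tsum_congr fun e => ?_
    change starRingEnd ℂ (a (E.s e) * ξ.1 e) * η.1 e
      = starRingEnd ℂ (ξ.1 e) * (star (a (E.s e)) * η.1 e)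
    rw [map_mul, starRingEnd_apply, starRingEnd_apply]
    ring

/-- An element of the normed space `X(E)` as a function on the edges. -/
def toX (ξ : E.strX.Space) : E.moduleX := ξ

theorem normX_sq (ξ : E.strX.Space) : ‖ξ‖ ^ 2 = ‖innerX (toX ξ) (toX ξ)‖ :=
  E.strX.space_norm_sq ξ

theorem norm_innerX_self_apply (ξ : E.moduleX) (v : E.Vertex) :
    ‖innerX ξ ξ v‖ = E.normSq ξ.1 v := by
  rw [innerX_self_apply, Complex.norm_real, Real.norm_of_nonneg (normSq_nonneg _ _)]

theorem normSq_le (ξ : E.strX.Space) (v : E.Vertex) : E.normSq (toX ξ).1 v ≤ ‖ξ‖ ^ 2 := by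
  rw [normX_sq, ← norm_innerX_self_apply]
  exact norm_coe_le _ v

theorem norm_apply_sq_le (ξ : E.strX.Space) (e : E.Edge) : ‖(toX ξ).1 e‖ ^ 2 ≤ ‖ξ‖ ^ 2 :=
  (((toX ξ).2.1 (E.r e)).le_tsum ⟨e, rfl⟩ fun _ _ => by positivity).trans
    (normSq_le ξ (E.r e))

theorem norm_le_of_normSq_le (ξ : E.strX.Space) (C : ℝ) (hC : 0 ≤ C)
    (h : ∀ v, E.normSq (toX ξ).1 v ≤ C ^ 2) : ‖ξ‖ ≤ C := by
  refine (pow_le_pow_iff_left₀ (norm_nonneg _) hC two_ne_zero).1 ?_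
  rw [normX_sq]
  refine (BoundedContinuousFunction.norm_le (f := (innerX (toX ξ) (toX ξ)).toBCF)
    (sq_nonneg C)).2 fun v => ?_
  exact (norm_innerX_self_apply _ v).trans_le (h v)

theorem eq_zero_of_norm_eq_zero (ξ : E.strX.Space) (h : ‖ξ‖ = 0) : ξ = 0 :=
  Subtype.ext <| funext fun e => by
    have := norm_apply_sq_le ξ e
    rw [h] at this
    have h0 : ‖(toX ξ).1 e‖ ^ 2 = 0 := le_antisymm (by simpa using this) (by positivity)
    exact norm_eq_zero.1 (pow_eq_zero_iff two_ne_zero |>.1 h0)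

instance completeSpaceX : CompleteSpace E.strX.Space := by
  refine UniformSpace.complete_of_cauchySeq_tendsto fun u hu => ?_
  let f : ℕ → E.Edge → ℂ := fun n => (toX (u n)).1
  have hf : ∀ n, E.MemX (f n) := fun n => (toX (u n)).2
  have hcau : ∀ ε > 0, ∃ N, ∀ n ≥ N, ∀ m ≥ N, ∀ v, E.normSq (f n - f m) v ≤ ε ^ 2 := by
    intro ε hε
    obtain ⟨N, hN⟩ := Metric.cauchySeq_iff.1 hu ε hε
    refine ⟨N, fun n hn m hm v => (normSq_le (u n - u m) v).trans ?_⟩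
    have := (hN n hn m hm).le
    rw [dist_eq_norm] at this
    exact pow_le_pow_left₀ (norm_nonneg _) this 2
  have hsub : ∀ n m, E.MemX (f n - f m) := fun n m => E.moduleX.sub_mem (hf n) (hf m)
  have hpt : ∀ e, CauchySeq fun n => f n e := by
    intro e
    refine Metric.cauchySeq_iff.2 fun ε hε => ?_
    obtain ⟨N, hN⟩ := hcau (ε / 2) (by positivity)
    refine ⟨N, fun n hn m hm => ?_⟩
    have h1 := ((hsub n m).1 (E.r e)).le_tsum ⟨e, rfl⟩ fun _ _ => by positivity
    have h2 := h1.trans (hN n hn m hm (E.r e))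
    have h3 := (pow_le_pow_iff_left₀ (norm_nonneg _) (by positivity) two_ne_zero).1 h2
    rw [dist_eq_norm]
    exact lt_of_le_of_lt h3 (by linarith)
  choose g hg using fun e => cauchySeq_tendsto_of_complete (hpt e)
  have hfin : ∀ ε > 0, ∃ N, ∀ n ≥ N, ∀ v, ∀ F : Finset (E.Fiber v),
      ∑ e ∈ F, ‖(f n - g) e‖ ^ 2 ≤ ε ^ 2 := by
    intro ε hε
    obtain ⟨N, hN⟩ := hcau ε hε
    refine ⟨N, fun n hn v F => ?_⟩
    have hlim : Filter.Tendsto (fun m => ∑ e ∈ F, ‖(f n - f m) e‖ ^ 2) Filter.atTop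
        (nhds (∑ e ∈ F, ‖(f n - g) e‖ ^ 2)) :=
      tendsto_finsetSum _ fun e _ => ((tendsto_const_nhds.sub (hg e)).norm).pow 2
    refine le_of_tendsto hlim ?_
    filter_upwards [Filter.eventually_ge_atTop N] with m hm
    exact (((hsub n m).1 v).sum_le_tsum F fun _ _ => by positivity).trans (hN n hn m hm v)
  have hsum : ∀ ε > 0, ∃ N, ∀ n ≥ N, ∀ v, (Summable fun e : E.Fiber v => ‖(f n - g) e‖ ^ 2) ∧
      E.normSq (f n - g) v ≤ ε ^ 2 := by
    intro ε hε
    obtain ⟨N, hN⟩ := hfin ε hε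
    refine ⟨N, fun n hn v => ?_⟩
    have h1 : Summable fun e : E.Fiber v => ‖(f n - g) e‖ ^ 2 :=
      summable_of_sum_le (fun _ => by positivity) (hN n hn v)
    exact ⟨h1, h1.tsum_le_of_sum_le (hN n hn v)⟩
  have hle : ∀ n e, ‖g e‖ ^ 2 ≤ 2 * ‖f n e‖ ^ 2 + 2 * ‖(f n - g) e‖ ^ 2 := fun n e => by
    have h := norm_add_sq_le (f n e) (-(f n - g) e)
    rw [norm_neg] at h
    simpa using h
  have hgmem : E.MemX g := by
    have hgs : ∀ v, Summable fun e : E.Fiber v => ‖g e‖ ^ 2 := by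
      intro v
      obtain ⟨N, hN⟩ := hsum 1 one_pos
      exact Summable.of_nonneg_of_le (fun _ => by positivity) (fun e => hle N e)
        ((((hf N).1 v).mul_left 2).add ((hN N le_rfl v).1.mul_left 2))
    refine ⟨hgs, ?_⟩
    rw [Metric.tendsto_nhds]
    intro ε hε
    obtain ⟨N, hN⟩ := hsum (√(ε / 8)) (by positivity)
    have h1 := (Metric.tendsto_nhds.1 (hf N).2) (ε / 4) (by positivity)
    filter_upwards [h1] with v hv
    rw [dist_zero_right, Real.norm_of_nonneg (normSq_nonneg _ _)] at hv ⊢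
    have h2 : E.normSq g v ≤ 2 * E.normSq (f N) v + 2 * E.normSq (f N - g) v := by
      refine (Summable.tsum_le_tsum (fun e : E.Fiber v => hle N e) (hgs v)
        ((((hf N).1 v).mul_left 2).add ((hN N le_rfl v).1.mul_left 2))).trans (le_of_eq ?_)
      rw [(((hf N).1 v).mul_left 2).tsum_add ((hN N le_rfl v).1.mul_left 2), tsum_mul_left,
        tsum_mul_left]
      rfl
    have h3 := (hN N le_rfl v).2
    rw [Real.sq_sqrt (by positivity)] at h3
    linarith
  let ξ : E.strX.Space := (⟨g, hgmem⟩ : E.moduleX)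
  refine ⟨ξ, ?_⟩
  rw [Metric.tendsto_atTop]
  intro ε hε
  obtain ⟨N, hN⟩ := hsum (ε / 2) (by positivity)
  refine ⟨N, fun n hn => ?_⟩
  rw [dist_eq_norm]
  refine lt_of_le_of_lt (norm_le_of_normSq_le _ (ε / 2) (by positivity) fun v => ?_)
    (half_lt_self hε)
  exact (hN n hn v).2

noncomputable instance normedAddCommGroupX : NormedAddCommGroup E.strX.Space :=
  NormedAddCommGroup.ofSeparation eq_zero_of_norm_eq_zero

variable (E) in
/-- The graph correspondence `X(E)` over `C₀(E⁰)`. -/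
noncomputable def correspondence : CStarCorrespondence C₀(E.Vertex, ℂ) where
  carrier := E.strX.Space
  normedAddCommGroup := normedAddCommGroupX
  normedSpace := inferInstanceAs (NormedSpace ℂ E.strX.Space)
  completeSpace := completeSpaceX
  str := E.strX.onSpace
  norm_sq := E.strX.space_norm_sq

variable (E)

/-- `E` has no sinks: every vertex is the source of an edge. -/
def NoSinks : Prop := ∀ v, ∃ e, E.s e = v

/-- `E` has no sources: every vertex is the range of an edge. -/
def NoSources : Prop := ∀ v, ∃ e, E.r e = v

/-- There is an edge from `v` to `w` or an edge from `w` to `v`. -/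
def Linked (v w : E.Vertex) : Prop :=
  ∃ e, (E.s e = v ∧ E.r e = w) ∨ (E.s e = w ∧ E.r e = v)

/-- `E` is weakly connected: any two vertices are joined by a finite sequence of vertices in which
consecutive vertices are linked by an edge in one of the two directions. -/
def WeaklyConnected : Prop := ∀ v w, Relation.ReflTransGen E.Linked v w

/-- `E` is a simple cycle: for some `n ≥ 0` its vertices are distinct `v₀, …, vₙ`, and its edges are
exactly `e₀, …, eₙ` with `eᵢ` from `vᵢ` to `vᵢ₊₁`, indices modulo `n + 1`. -/
def IsSimpleCycle : Prop :=
  ∃ (n : ℕ) (v : Fin (n + 1) ≃ E.Vertex) (e : Fin (n + 1) ≃ E.Edge),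
    ∀ i, E.s (e i) = v i ∧ E.r (e i) = v (i + 1)

end DirectedGraph

/-!
The indicators of paths of length `n` are elementary tensors of edge indicators in `X(E)^{⊗ n}`;
the left action sees the source of a path and the inner product sees its range.

If `X(E)^{⊗ n} ≅ A` with `n ≥ 1`, then `A` acts faithfully from the left, so there are no sinks and
every edge starts a path of length `n`. As `A` is commutative, its two actions on itself agree, and
this forces each such path to be closed; moreover Cauchy–Schwarz is an equality in `A`, so distinct
edges, whose paths are orthogonal, have distinct sources. Hence moving along the graph is a
permutation of the edges of finite order, and by connectedness it has a single orbit.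

Conversely, on a simple cycle with `n` edges the `n` closed paths of length `n` span `X(E)^{⊗ n}`,
and their sum `ξ` satisfies `⟨ξ, a · ξ⟩ = a`, so `a ↦ a · ξ` is an isomorphism from `A`.
-/

namespace CStarCorrespondence

universe u

section NonUnitalCStarAlgebra

variable {A : Type u} [NonUnitalCStarAlgebra A]

theorem eq_zero_of_inner_self_eq_zero (X : CStarCorrespondence A) {x : X.carrier}
    (h : X.str.inner x x = 0) : x = 0 := by
  rw [← norm_eq_zero, ← sq_eq_zero_iff, X.norm_sq, h, norm_zero]

/-- The canonical bilinear map `(x, y) ↦ x ⊗ y` into the completed balanced tensor product. -/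
noncomputable def tmul (X Y : CStarCorrespondence A) :
    X.carrier →ₗ[ℂ] Y.carrier →ₗ[ℂ] (X.tensor Y).carrier :=
  (TensorProduct.mk ℂ X.carrier Y.carrier).compr₂
    (UniformSpace.Completion.toComplL (𝕜 := ℂ) (E := (X.str.tensor Y.str).Space)).toLinearMap

section Tensor

variable (X Y : CStarCorrespondence A)

theorem inner_tmul (x x' : X.carrier) (y y' : Y.carrier) :
    (X.tensor Y).str.inner (tmul X Y x y) (tmul X Y x' y')
      = Y.str.inner y (Y.str.left (X.str.inner x x') y') :=
  (X.str.tensor Y.str).innerCompl_coe _ _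

theorem left_tmul (a : A) (x : X.carrier) (y : Y.carrier) :
    (X.tensor Y).str.left a (tmul X Y x y) = tmul X Y (X.str.left a x) y :=
  (X.str.tensor Y.str).leftCompl_coe _ _

theorem topologicalClosure_map₂_tmul :
    (Submodule.map₂ (tmul X Y) ⊤ ⊤).topologicalClosure = ⊤ := by
  let ι : (X.str.tensor Y.str).Space →L[ℂ] (X.tensor Y).carrier := UniformSpace.Completion.toComplL
  have hdense : DenseRange ι := UniformSpace.Completion.denseRange_coe
  have hrange : ∀ t : X.carrier ⊗[ℂ] Y.carrier, ι t ∈ Submodule.map₂ (tmul X Y) ⊤ ⊤ := fun t => by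
    induction t with
    | zero => exact (map_zero ι).symm ▸ Submodule.zero_mem _
    | add t t' ht ht' => exact (map_add ι t t').symm ▸ Submodule.add_mem _ ht ht'
    | tmul x y => exact Submodule.apply_mem_map₂ _ Submodule.mem_top Submodule.mem_top
  exact Submodule.dense_iff_topologicalClosure_eq_top.1
    (hdense.mono (Set.range_subset_iff.2 hrange))

theorem span_tmul_eq_top {ι κ : Type*} [Finite ι] [Finite κ] {x : ι → X.carrier}
    {y : κ → Y.carrier} (hx : Submodule.span ℂ (Set.range x) = ⊤)
    (hy : Submodule.span ℂ (Set.range y) = ⊤) :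
    Submodule.span ℂ (Set.range fun p : ι × κ => tmul X Y (x p.1) (y p.2)) = ⊤ := by
  set S := Submodule.span ℂ (Set.range fun p : ι × κ => tmul X Y (x p.1) (y p.2))
  have hdense : S.topologicalClosure = ⊤ := by
    rw [← topologicalClosure_map₂_tmul, ← hx, ← hy, Submodule.map₂_span_span, Set.image2_range]
  have hfin : FiniteDimensional ℂ S := FiniteDimensional.span_of_finite ℂ (Set.finite_range _)
  have hclosed : IsClosed (S : Set (X.tensor Y).carrier) := S.closed_of_finiteDimensional
  rwa [hclosed.submodule_topologicalClosure_eq] at hdense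

variable {X}

theorem left_tensor_eq_zero {a : A} (h : X.str.left a = 0) : (X.tensor Y).str.left a = 0 := by
  refine LinearMap.ext fun z => ?_
  have hclosed : IsClosed {z | (X.str.tensor Y.str).leftCompl a z = 0} :=
    isClosed_eq ((X.str.tensor Y.str).leftCompl_continuous a) continuous_const
  refine UniformSpace.Completion.induction_on z hclosed fun t => ?_
  have hrTensor : LinearMap.rTensor Y.carrier (X.str.left a) = 0 := by
    rw [h, LinearMap.rTensor_zero]
  exact ((X.str.tensor Y.str).leftCompl_coe a t).trans
    ((congrArg _ (LinearMap.congr_fun hrTensor t)).trans UniformSpace.Completion.coe_zero)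

theorem left_tensorPower_succ_eq_zero {a : A} (h : X.str.left a = 0) :
    ∀ n : ℕ, (X.tensorPower (n + 1)).str.left a = 0
  | 0 => h
  | n + 1 => left_tensor_eq_zero (X.tensorPower (n + 1)) h

end Tensor

section Isomorphic

variable {X Y : CStarCorrespondence A}

theorem Isomorphic.symm : Isomorphic X Y → Isomorphic Y X := by
  rintro ⟨Φ, hΦ, hleft, hinner⟩
  obtain ⟨Ψ, hΨΦ, hΦΨ⟩ := Function.bijective_iff_has_inverse.1 hΦ
  refine ⟨Ψ, Function.bijective_iff_has_inverse.2 ⟨Φ, hΦΨ, hΨΦ⟩, fun a y => ?_, fun y y' => ?_⟩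
  · rw [← hΨΦ (X.str.left a (Ψ y)), hleft, hΦΨ]
  · rw [← hinner, hΦΨ, hΦΨ]

theorem Isomorphic.of_surjective (Ψ : X.carrier →ₗ[ℂ] Y.carrier) (hΨ : Function.Surjective Ψ)
    (hleft : ∀ a x, Ψ (X.str.left a x) = Y.str.left a (Ψ x))
    (hinner : ∀ x x', Y.str.inner (Ψ x) (Ψ x') = X.str.inner x x') : Isomorphic X Y := by
  have hinj : Function.Injective Ψ := (injective_iff_map_eq_zero Ψ).2 fun x hx =>
    X.eq_zero_of_inner_self_eq_zero (by rw [← hinner, hx, map_zero])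
  exact ⟨Ψ, ⟨hinj, hΨ⟩, hleft, hinner⟩

theorem isomorphic_identity_iff : Isomorphic X (identity A) ↔ ∃ Φ : X.carrier → A,
    Function.Bijective Φ ∧ (∀ a x, Φ (X.str.left a x) = a * Φ x) ∧
      ∀ x x', star (Φ x) * Φ x' = X.str.inner x x' :=
  Iff.rfl

theorem isomorphic_identity_of_cyclic (ξ : X.carrier)
    (hinner : ∀ a, X.str.inner ξ (X.str.left a ξ) = a)
    (hcyclic : ∀ x, ∃ a, X.str.left a ξ = x) : Isomorphic X (identity A) := by
  refine (Isomorphic.of_surjective (X := identity A) (X.str.left.flip ξ) hcyclic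
    (fun a b => X.str.left_mul a b ξ) fun (a b : A) => ?_).symm
  change X.str.inner (X.str.left a ξ) (X.str.left b ξ) = star a * b
  rw [X.str.inner_left, ← X.str.left_mul, hinner]

theorem Isomorphic.eq_zero_of_left_eq_zero (h : Isomorphic X (identity A)) {a : A}
    (ha : X.str.left a = 0) : a = 0 := by
  obtain ⟨Φ, hΦ, hleft, hinner⟩ := isomorphic_identity_iff.1 h
  obtain ⟨x, hx⟩ := hΦ.surjective (star a)
  have hself := hinner (X.str.left a x) (X.str.left a x)
  rw [hleft, hx, ha, LinearMap.zero_apply, map_zero] at hself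
  exact (CStarRing.mul_star_self_eq_zero_iff a).1 ((CStarRing.star_mul_self_eq_zero_iff _).1 hself)

end Isomorphic

end NonUnitalCStarAlgebra

section Commutative

variable {A : Type u} [NonUnitalCommCStarAlgebra A] {X : CStarCorrespondence A}

theorem Isomorphic.inner_left_eq_inner_mul (h : Isomorphic X (identity A)) (a : A)
    (x y : X.carrier) : X.str.inner x (X.str.left a y) = X.str.inner x y * a := by
  obtain ⟨Φ, -, hleft, hinner⟩ := isomorphic_identity_iff.1 h
  rw [← hinner, ← hinner, hleft, mul_comm a, mul_assoc]

theorem Isomorphic.star_inner_mul_inner (h : Isomorphic X (identity A)) (x y : X.carrier) :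
    star (X.str.inner x y) * X.str.inner x y = X.str.inner x x * X.str.inner y y := by
  obtain ⟨Φ, -, -, hinner⟩ := isomorphic_identity_iff.1 h
  simp only [← hinner, star_mul, star_star]
  rw [mul_comm (star (Φ y)), mul_mul_mul_comm, mul_comm (Φ x), mul_comm]

end Commutative

end CStarCorrespondence

namespace DirectedGraph

open CStarCorrespondence

universe u

variable {E : DirectedGraph.{u}}

section VertexIndicator

open scoped Classical in
/-- The indicator function `δ_v` of a vertex, as an element of `C₀(E⁰)`. -/
noncomputable def vertexIndicator (v : E.Vertex) : C₀(E.Vertex, ℂ) where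
  toFun := Pi.single v 1
  continuous_toFun := continuous_of_discreteTopology
  zero_at_infty' := HasCompactSupport.is_zero_at_infty
    (.intro isCompact_singleton fun _ hw => Pi.single_eq_of_ne hw 1)

theorem vertexIndicator_self (v : E.Vertex) : vertexIndicator v v = 1 := by
  classical exact Pi.single_eq_same v 1

theorem vertexIndicator_of_ne {v w : E.Vertex} (h : w ≠ v) : vertexIndicator v w = 0 := by
  classical exact Pi.single_eq_of_ne h 1

theorem eq_of_vertexIndicator_mul_vertexIndicator_ne_zero {v w : E.Vertex}
    (h : vertexIndicator v * vertexIndicator w ≠ 0) : v = w := by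
  contrapose! h
  refine ZeroAtInftyContinuousMap.ext fun u => ?_
  rw [ZeroAtInftyContinuousMap.mul_apply, ZeroAtInftyContinuousMap.zero_apply]
  rcases eq_or_ne u v with rfl | hu
  · rw [vertexIndicator_of_ne h, mul_zero]
  · rw [vertexIndicator_of_ne hu, zero_mul]

theorem vertexIndicator_ne_zero (v : E.Vertex) : vertexIndicator v ≠ 0 := fun h => by
  simpa [vertexIndicator_self] using congrArg (fun a : C₀(E.Vertex, ℂ) => a v) h

theorem vertexIndicator_mul_self (v : E.Vertex) :
    vertexIndicator v * vertexIndicator v = vertexIndicator v := by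
  refine ZeroAtInftyContinuousMap.ext fun w => ?_
  rw [ZeroAtInftyContinuousMap.mul_apply]
  rcases eq_or_ne w v with rfl | hw
  · rw [vertexIndicator_self, mul_one]
  · rw [vertexIndicator_of_ne hw, mul_zero]

theorem sum_smul_vertexIndicator [Fintype E.Vertex] (a : C₀(E.Vertex, ℂ)) :
    ∑ v, a v • vertexIndicator v = a := by
  classical
  let coeHom : C₀(E.Vertex, ℂ) →+ (E.Vertex → ℂ) :=
    { toFun := (⇑), map_zero' := rfl, map_add' := fun _ _ => rfl }
  exact DFunLike.coe_injective ((map_sum coeHom _ _).trans (pi_eq_sum_univ' a).symm)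

end VertexIndicator

section EdgeIndicator

open scoped Classical in
theorem memX_single (e : E.Edge) : E.MemX (Pi.single e 1) := by
  have hzero : ∀ f, f ≠ e → ‖(Pi.single e 1 : E.Edge → ℂ) f‖ ^ 2 = 0 := fun f hf => by
    rw [Pi.single_eq_of_ne hf, norm_zero, zero_pow two_ne_zero]
  refine ⟨fun v => ((hasSum_single e hzero).summable).comp_injective Subtype.val_injective,
    HasCompactSupport.is_zero_at_infty
      (.intro (isCompact_singleton (x := E.r e)) fun v hv => ?_)⟩
  refine (tsum_congr fun f : E.Fiber v => hzero f.1 ?_).trans tsum_zero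
  rintro rfl
  exact hv f.2.symm

open scoped Classical in
/-- The indicator function `δ_e` of an edge, as an element of `X(E)`. -/
noncomputable def edgeIndicator (e : E.Edge) : E.correspondence.carrier :=
  (⟨Pi.single e 1, memX_single e⟩ : E.moduleX)

theorem left_edgeIndicator (a : C₀(E.Vertex, ℂ)) (e : E.Edge) :
    E.correspondence.str.left a (edgeIndicator e) = a (E.s e) • edgeIndicator e := by
  classical
  refine Subtype.ext (funext fun f => ?_)
  change a (E.s f) * (Pi.single e 1 : E.Edge → ℂ) f = a (E.s e) * (Pi.single e 1 : E.Edge → ℂ) f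
  rcases eq_or_ne f e with rfl | hf
  · rfl
  · rw [Pi.single_eq_of_ne hf, mul_zero, mul_zero]

theorem inner_edgeIndicator (e : E.Edge) (ξ : E.correspondence.carrier) :
    E.correspondence.str.inner (edgeIndicator e) ξ = (toX ξ).1 e • vertexIndicator (E.r e) := by
  classical
  refine ZeroAtInftyContinuousMap.ext fun v => ?_
  change ∑' f : E.Fiber v, starRingEnd ℂ ((Pi.single e 1 : E.Edge → ℂ) f) * (toX ξ).1 f
    = (toX ξ).1 e * vertexIndicator (E.r e) v
  have hzero : ∀ f : E.Edge, f ≠ e →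
      starRingEnd ℂ ((Pi.single e 1 : E.Edge → ℂ) f) * (toX ξ).1 f = 0 := fun f hf => by
    rw [Pi.single_eq_of_ne hf, map_zero, zero_mul]
  rcases eq_or_ne v (E.r e) with rfl | hv
  · rw [tsum_eq_single (⟨e, rfl⟩ : E.Fiber (E.r e)) fun f hf => hzero f (hf <| Subtype.ext ·),
      Pi.single_eq_same, map_one, one_mul, vertexIndicator_self, mul_one]
  · rw [vertexIndicator_of_ne hv, mul_zero]
    refine (tsum_congr fun f : E.Fiber v => hzero f.1 ?_).trans tsum_zero
    rintro rfl
    exact hv f.2.symm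

theorem inner_edgeIndicator_self (e : E.Edge) :
    E.correspondence.str.inner (edgeIndicator e) (edgeIndicator e) = vertexIndicator (E.r e) := by
  classical
  rw [inner_edgeIndicator]
  exact (congrArg (· • _) (Pi.single_eq_same e 1)).trans (one_smul ℂ _)

theorem inner_edgeIndicator_of_ne {e f : E.Edge} (h : e ≠ f) :
    E.correspondence.str.inner (edgeIndicator e) (edgeIndicator f) = 0 := by
  classical
  rw [inner_edgeIndicator]
  exact (congrArg (· • _) (Pi.single_eq_of_ne h 1)).trans (zero_smul ℂ _)

theorem span_range_edgeIndicator [Finite E.Edge] :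
    Submodule.span ℂ (Set.range (edgeIndicator (E := E))) = ⊤ := by
  classical
  have := Fintype.ofFinite E.Edge
  refine eq_top_iff.2 fun ξ _ => (Submodule.mem_span_range_iff_exists_fun ℂ).2 ⟨(toX ξ).1, ?_⟩
  exact Subtype.ext ((map_sum E.moduleX.subtype _ _).trans (pi_eq_sum_univ' (toX ξ).1).symm)

theorem left_vertexIndicator_eq_zero {v : E.Vertex} (hv : ∀ e, E.s e ≠ v) :
    E.correspondence.str.left (vertexIndicator v) = 0 :=
  LinearMap.ext fun ξ => Subtype.ext <| funext fun e =>
    (congrArg (· * (toX ξ).1 e) (vertexIndicator_of_ne (hv e))).trans (zero_mul _)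

end EdgeIndicator

section PathVector

/-- The indicator `δ_e ⊗ δ_{g e} ⊗ ⋯ ⊗ δ_{gⁿ e}` of the path of `n + 1` edges that starts with `e`
and in which each edge `f` is followed by `g f`. It vanishes unless each of these edges starts where
the previous one ends. -/
noncomputable def pathVector (g : E.Edge → E.Edge) :
    (n : ℕ) → E.Edge → (E.correspondence.tensorPower (n + 1)).carrier
  | 0, e => edgeIndicator e
  | n + 1, e => tmul _ _ (edgeIndicator e) (pathVector g n (g e))

variable {g : E.Edge → E.Edge}

theorem left_pathVector (a : C₀(E.Vertex, ℂ)) (n : ℕ) (e : E.Edge) :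
    (E.correspondence.tensorPower (n + 1)).str.left a (pathVector g n e)
      = a (E.s e) • pathVector g n e := by
  cases n with
  | zero => exact left_edgeIndicator a e
  | succ n =>
    refine (left_tmul _ _ _ _ _).trans ?_
    rw [left_edgeIndicator, map_smul, LinearMap.smul_apply]
    rfl

theorem left_vertexIndicator_pathVector (n : ℕ) (e : E.Edge) :
    (E.correspondence.tensorPower (n + 1)).str.left (vertexIndicator (E.s e)) (pathVector g n e)
      = pathVector g n e := by
  rw [left_pathVector, vertexIndicator_self, one_smul]

theorem inner_pathVector_self (hg : ∀ e, E.s (g e) = E.r e) (n : ℕ) (e : E.Edge) :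
    (E.correspondence.tensorPower (n + 1)).str.inner (pathVector g n e) (pathVector g n e)
      = vertexIndicator (E.r (g^[n] e)) := by
  induction n generalizing e with
  | zero => exact inner_edgeIndicator_self e
  | succ n ih =>
    refine (inner_tmul _ _ _ _ _ _).trans ?_
    rw [inner_edgeIndicator_self, ← hg, left_vertexIndicator_pathVector, ih,
      Function.iterate_succ_apply]

theorem inner_pathVector_of_ne {e f : E.Edge} (h : e ≠ f) (n : ℕ) :
    (E.correspondence.tensorPower (n + 1)).str.inner (pathVector g n e) (pathVector g n f) = 0 := by
  cases n with
  | zero => exact inner_edgeIndicator_of_ne h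
  | succ n =>
    refine (inner_tmul _ _ _ _ _ _).trans ?_
    rw [inner_edgeIndicator_of_ne h, map_zero, LinearMap.zero_apply, map_zero]

theorem tmul_edgeIndicator_pathVector_eq_zero {e f : E.Edge} (h : E.s f ≠ E.r e) (n : ℕ) :
    tmul _ (E.correspondence.tensorPower (n + 1)) (edgeIndicator e) (pathVector g n f) = 0 := by
  refine eq_zero_of_inner_self_eq_zero _ ((inner_tmul _ _ _ _ _ _).trans ?_)
  rw [inner_edgeIndicator_self, left_pathVector, vertexIndicator_of_ne h, zero_smul, map_zero]

theorem span_range_pathVector [Finite E.Edge] (hs : Function.Injective E.s)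
    (hg : ∀ e, E.s (g e) = E.r e) (n : ℕ) :
    Submodule.span ℂ (Set.range (pathVector g n)) = ⊤ := by
  induction n with
  | zero => exact span_range_edgeIndicator
  | succ n ih =>
    let T (e f : E.Edge) :
        (E.correspondence.tensor (E.correspondence.tensorPower (n + 1))).carrier :=
      tmul _ _ (edgeIndicator e) (pathVector g n f)
    have hle : Submodule.span ℂ (Set.range fun p : E.Edge × E.Edge => T p.1 p.2)
        ≤ Submodule.span ℂ (Set.range fun e => T e (g e)) := by
      rw [Submodule.span_le]
      rintro _ ⟨⟨e, f⟩, rfl⟩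
      by_cases hf : E.s f = E.r e
      · obtain rfl : f = g e := hs (hf.trans (hg e).symm)
        exact Submodule.subset_span ⟨e, rfl⟩
      · exact Set.mem_of_eq_of_mem (tmul_edgeIndicator_pathVector_eq_zero hf n)
          (Submodule.zero_mem _)
    exact top_le_iff.1 ((span_tmul_eq_top _ _ span_range_edgeIndicator ih).ge.trans hle)

end PathVector

section Periodic

variable {g : E.Edge → E.Edge} {n : ℕ}

theorem isomorphic_identity_of_range_iterate_eq_source [Finite E.Vertex]
    (hs : Function.Bijective E.s) (hg : ∀ e, E.s (g e) = E.r e)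
    (hclosed : ∀ e, E.r (g^[n] e) = E.s e) :
    Isomorphic (E.correspondence.tensorPower (n + 1)) (identity C₀(E.Vertex, ℂ)) := by
  classical
  have := Fintype.ofFinite E.Vertex
  have : Finite E.Edge := .of_injective E.s hs.injective
  have := Fintype.ofFinite E.Edge
  set Y := E.correspondence.tensorPower (n + 1)
  set ξ : Y.carrier := ∑ e, pathVector g n e with hξ
  have hleft : ∀ a, Y.str.left a ξ = ∑ e, a (E.s e) • pathVector g n e := fun a => by
    rw [hξ, map_sum]
    exact Finset.sum_congr rfl fun e _ => left_pathVector a n e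
  have hpath : ∀ e, Y.str.inner ξ (pathVector g n e) = vertexIndicator (E.s e) := fun e => by
    rw [hξ, map_sum, LinearMap.sum_apply,
      Finset.sum_eq_single e (fun f _ hf => inner_pathVector_of_ne hf n) (by simp),
      inner_pathVector_self hg, hclosed]
  refine isomorphic_identity_of_cyclic ξ (fun a => ?_)
    (show Function.Surjective (Y.str.left.flip ξ) from LinearMap.range_eq_top.1 ?_)
  · simp only [hleft, map_sum, map_smul, hpath]
    rw [hs.sum_comp fun v => a v • vertexIndicator v, sum_smul_vertexIndicator]
  · rw [← top_le_iff, ← span_range_pathVector hs.injective hg n, Submodule.span_le]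
    rintro _ ⟨e, rfl⟩
    refine ⟨vertexIndicator (E.s e), (hleft _).trans ?_⟩
    rw [Finset.sum_eq_single e (fun f _ hf => ?_) (by simp), vertexIndicator_self, one_smul]
    rw [vertexIndicator_of_ne (hs.injective.ne hf), zero_smul]

theorem noSinks_of_isomorphic_identity
    (h : Isomorphic (E.correspondence.tensorPower (n + 1)) (identity C₀(E.Vertex, ℂ))) :
    E.NoSinks := fun v => by
  by_contra! hv
  exact vertexIndicator_ne_zero v (h.eq_zero_of_left_eq_zero
    (left_tensorPower_succ_eq_zero (left_vertexIndicator_eq_zero hv) n))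

theorem range_iterate_eq_source_of_isomorphic_identity (hg : ∀ e, E.s (g e) = E.r e)
    (h : Isomorphic (E.correspondence.tensorPower (n + 1)) (identity C₀(E.Vertex, ℂ)))
    (e : E.Edge) : E.r (g^[n] e) = E.s e := by
  have hmul := h.inner_left_eq_inner_mul (vertexIndicator (E.s e)) (pathVector g n e)
    (pathVector g n e)
  rw [left_vertexIndicator_pathVector, inner_pathVector_self hg] at hmul
  exact eq_of_vertexIndicator_mul_vertexIndicator_ne_zero
    (hmul ▸ vertexIndicator_ne_zero _)

theorem injective_source_of_isomorphic_identity (hg : ∀ e, E.s (g e) = E.r e)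
    (h : Isomorphic (E.correspondence.tensorPower (n + 1)) (identity C₀(E.Vertex, ℂ))) :
    Function.Injective E.s := fun e f hef => by
  by_contra hne
  have hclosed := range_iterate_eq_source_of_isomorphic_identity hg h
  have hmul := h.star_inner_mul_inner (pathVector g n e) (pathVector g n f)
  rw [inner_pathVector_of_ne hne, mul_zero, inner_pathVector_self hg, inner_pathVector_self hg,
    hclosed, hclosed, hef, vertexIndicator_mul_self] at hmul
  exact vertexIndicator_ne_zero _ hmul.symm

end Periodic

section SimpleCycle

variable {g : E.Edge → E.Edge}

theorem WeaklyConnected.exists_iterate_eq (hconn : E.WeaklyConnected)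
    (hs : Function.Injective E.s) (hg : ∀ e, E.s (g e) = E.r e) {n : ℕ}
    (hperiod : ∀ e, g^[n + 1] e = e) (e₀ e : E.Edge) : ∃ k, g^[k] e₀ = e := by
  suffices h : ∀ v, Relation.ReflTransGen E.Linked (E.s e₀) v →
      ∀ e, E.s e = v → ∃ k, g^[k] e₀ = e from h _ (hconn _ _) e rfl
  intro v hv
  induction hv with
  | refl => exact fun e he => ⟨0, hs he.symm⟩
  | tail _ hlink ih =>
    rintro e rfl
    obtain ⟨f, ⟨hfs, hfr⟩ | ⟨hfs, hfr⟩⟩ := hlink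
    · obtain ⟨k, rfl⟩ := ih f hfs
      exact ⟨k + 1, hs <| by rw [Function.iterate_succ_apply', hg, hfr]⟩
    · obtain rfl : f = e := hs hfs
      obtain ⟨k, hk⟩ := ih (g f) ((hg f).trans hfr)
      exact ⟨n + k, by rw [Function.iterate_add_apply, hk]; exact hperiod f⟩

theorem isSimpleCycle_of_forall_exists_iterate_eq (hs : Function.Bijective E.s)
    (hg : ∀ e, E.s (g e) = E.r e) {e₀ : E.Edge} (hperiodic : e₀ ∈ Function.periodicPts g)
    (horbit : ∀ e, ∃ k, g^[k] e₀ = e) : E.IsSimpleCycle := by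
  obtain ⟨n, hn⟩ := Nat.exists_eq_succ_of_ne_zero
    (Function.minimalPeriod_pos_of_mem_periodicPts hperiodic).ne'
  have hmod : ∀ k, g^[k % (n + 1)] e₀ = g^[k] e₀ := fun k => by
    rw [← Nat.succ_eq_add_one, ← hn, Function.iterate_mod_minimalPeriod_eq]
  have hinj : Function.Injective fun i : Fin (n + 1) => g^[i] e₀ := fun i j hij =>
    Fin.ext (Function.iterate_injOn_Iio_minimalPeriod (hn ▸ i.2) (hn ▸ j.2) hij)
  have hsurj : Function.Surjective fun i : Fin (n + 1) => g^[i] e₀ := fun e => by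
    obtain ⟨k, rfl⟩ := horbit e
    exact ⟨⟨k % (n + 1), Nat.mod_lt _ n.succ_pos⟩, hmod k⟩
  let edge : Fin (n + 1) ≃ E.Edge := .ofBijective _ ⟨hinj, hsurj⟩
  refine ⟨n, edge.trans (.ofBijective E.s hs), edge, fun i => ⟨rfl, ?_⟩⟩
  change E.r (g^[i] e₀) = E.s (g^[(i + 1 : Fin (n + 1))] e₀)
  rw [Fin.val_add, Fin.val_one', Nat.add_mod_mod, hmod, Function.iterate_succ_apply', hg]

theorem IsSimpleCycle.exists_isomorphic_identity (hE : E.IsSimpleCycle) :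
    ∃ n, Isomorphic (E.correspondence.tensorPower (n + 1)) (identity C₀(E.Vertex, ℂ)) := by
  obtain ⟨n, v, e, h⟩ := hE
  have : Finite E.Vertex := .of_equiv _ v
  have hse : E.s = v ∘ e.symm := by
    funext f
    obtain ⟨i, rfl⟩ := e.surjective f
    simp [(h i).1]
  let g : E.Edge → E.Edge := fun f => e (e.symm f + 1)
  have hg : ∀ f, E.s (g f) = E.r f := fun f => by
    rw [(h _).1, ← (h _).2, e.apply_symm_apply]
  have hiterate : g^[n + 1] = id := by
    have hsemiconj : Function.Semiconj e (· + 1) g := fun i => by simp [g]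
    funext f
    obtain ⟨i, rfl⟩ := e.surjective f
    rw [← (hsemiconj.iterate_right (n + 1)) i, add_right_iterate]
    have hcard : (n + 1) • (1 : Fin (n + 1)) = 0 := by
      simpa using! card_nsmul_eq_zero' (x := (1 : Fin (n + 1)))
    simp [hcard]
  refine ⟨n, isomorphic_identity_of_range_iterate_eq_source
    (hse ▸ v.bijective.comp e.symm.bijective) hg fun f => ?_⟩
  rw [← hg, ← Function.iterate_succ_apply' g, hiterate, id]

theorem isSimpleCycle_of_isomorphic_identity [Nonempty E.Vertex] (hconn : E.WeaklyConnected)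
    {n : ℕ} (h : Isomorphic (E.correspondence.tensorPower (n + 1)) (identity C₀(E.Vertex, ℂ))) :
    E.IsSimpleCycle := by
  have hsinks := noSinks_of_isomorphic_identity h
  choose g hg using fun e => hsinks (E.r e)
  have hs := injective_source_of_isomorphic_identity hg h
  have hperiod : ∀ e, g^[n + 1] e = e := fun e => hs <| by
    rw [Function.iterate_succ_apply', hg, range_iterate_eq_source_of_isomorphic_identity hg h]
  obtain ⟨e₀, -⟩ := hsinks (Classical.arbitrary E.Vertex)
  exact isSimpleCycle_of_forall_exists_iterate_eq ⟨hs, hsinks⟩ hg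
    (Function.mk_mem_periodicPts n.succ_pos (hperiod e₀))
    (hconn.exists_iterate_eq hs hg hperiod e₀)

end SimpleCycle

end DirectedGraph

theorem mainTheorem8_general (E : DirectedGraph) [Nonempty E.Vertex] (hconn : E.WeaklyConnected) :
    E.correspondence.Nonperiodic ↔ ¬ E.IsSimpleCycle := by
  refine ⟨fun hX hE => ?_, fun hE n hn => ?_⟩
  · obtain ⟨n, hn⟩ := hE.exists_isomorphic_identity
    exact n.succ_ne_zero (hX _ hn)
  · cases n with
    | zero => rfl
    | succ n => exact absurd (DirectedGraph.isSimpleCycle_of_isomorphic_identity hconn hn) hE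

theorem mainTheorem8 (E : DirectedGraph) [Nonempty E.Vertex] [Finite E.Vertex]
    (hconn : E.WeaklyConnected) (hsinks : E.NoSinks) (hsources : E.NoSources) :
    E.correspondence.Nonperiodic ↔ ¬ E.IsSimpleCycle :=
  mainTheorem8_general E hconn
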